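/- Let $\Gamma=(V,E,s,r)$ be a directed graph: $V$ and $E$ are arbitrary sets (of vertices and edges) and $s,r:E\to V$ are arbitrary maps (source and range). Let $\mathrm{Inv}(\Gamma)$ be the graph inverse semigroup of $\Gamma$, that is, the semigroup with zero generated by $V$, $E$ and $E^*=\{e^*: e\in E\}$ subject to the relations, for all $u,v\in V$ and $e,f\in E$, \[ uv=\delta_{u,v}\,u,\qquad s(e)\,e=e\,r(e)=e,\qquad r(e)\,e^*=e^*\,s(e)=e^*,\qquad f^*e=\delta_{f,e}\,r(e), \] where $\delta$ is the Kronecker delta. Let $\mathscr{C}(\mathrm{Inv}(\Gamma))$ be the lattice of all congruences on the semigroup $\mathrm{Inv}(\Gamma)$, ordered by inclusion. Then $\mathscr{C}(\mathrm{Inv}(\Gamma))$ is modular (that is, $a\le c$ implies $a\vee(b\wedge c)=(a\vee b)\wedge c$ for all $a,b,c$) if and only if it is distributive (that is, $(a\vee b)\wedge c=(a\wedge c)\vee(b\wedge c)$ for all $a,b,c$). -/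

import Mathlib

universe u v

/-- A directed graph `(V, E, s, r)`: arbitrary types of vertices and edges (loops and
multiple edges are allowed), with source map `s` and range map `r`. -/
structure DirectedGraph (V : Type u) (E : Type v) where
  /-- the source of an edge -/
  s : E → V
  /-- the range of an edge -/
  r : E → V

namespace DirectedGraph

variable {V : Type u} {E : Type v}

/-- The letters generating the graph inverse semigroup: vertices, edges `e`, and formal
inverses `e*` of edges. -/
inductive Gen (V : Type u) (E : Type v) : Type (max u v)
  | vert (a : V)
  | edge (e : E)
  | star (e : E)

/-- The free semigroup with zero on the letters: the free semigroup with a zero adjoined. -/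
abbrev FreeWithZero (V : Type u) (E : Type v) : Type (max u v) :=
  WithZero (FreeSemigroup (Gen V E))

/-- The letter `a`, for a vertex `a`, in the free semigroup with zero. -/
def wv (a : V) : FreeWithZero V E := ((FreeSemigroup.of (Gen.vert a) : FreeSemigroup (Gen V E)) :)

/-- The letter `e`, for an edge `e`, in the free semigroup with zero. -/
def we (e : E) : FreeWithZero V E := ((FreeSemigroup.of (Gen.edge e) : FreeSemigroup (Gen V E)) :)

/-- The letter `e*`, for an edge `e`, in the free semigroup with zero. -/
def ws (e : E) : FreeWithZero V E := ((FreeSemigroup.of (Gen.star e) : FreeSemigroup (Gen V E)) :)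

/-- The defining relations of the graph inverse semigroup. -/
inductive InvRel (Γ : DirectedGraph V E) : FreeWithZero V E → FreeWithZero V E → Prop
  /-- `a a = a` -/
  | vert_self (a : V) : InvRel Γ (wv a * wv a) (wv a)
  /-- `a b = 0` for distinct vertices -/
  | vert_ne (a b : V) (h : a ≠ b) : InvRel Γ (wv a * wv b) 0
  /-- `s(e) e = e` -/
  | source_edge (e : E) : InvRel Γ (wv (Γ.s e) * we e) (we e)
  /-- `e r(e) = e` -/
  | edge_range (e : E) : InvRel Γ (we e * wv (Γ.r e)) (we e)
  /-- `r(e) e* = e*` -/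
  | range_star (e : E) : InvRel Γ (wv (Γ.r e) * ws e) (ws e)
  /-- `e* s(e) = e*` -/
  | star_source (e : E) : InvRel Γ (ws e * wv (Γ.s e)) (ws e)
  /-- `e* e = r(e)` -/
  | star_edge_self (e : E) : InvRel Γ (ws e * we e) (wv (Γ.r e))
  /-- `f* e = 0` for distinct edges -/
  | star_edge_ne (f e : E) (h : f ≠ e) : InvRel Γ (ws f * we e) 0

/-- The graph inverse semigroup `Inv(Γ)`: the semigroup with zero presented by the letters
`a`, `e`, `e*` and the relations `InvRel Γ`. Its semigroup structure is the quotient one, and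
its zero is the class of `0`. -/
abbrev Inv (Γ : DirectedGraph V E) : Type (max u v) := (conGen (InvRel Γ)).Quotient

end DirectedGraph

/-- A lattice is distributive if `(a ⊔ b) ⊓ c = (a ⊓ c) ⊔ (b ⊓ c)` for all `a`, `b`, `c`. -/
def LatticeIsDistributive (L : Type*) [Lattice L] : Prop :=
  ∀ a b c : L, (a ⊔ b) ⊓ c = (a ⊓ c) ⊔ (b ⊓ c)

/-- A lattice is modular if `a ≤ c` implies `a ⊔ (b ⊓ c) = (a ⊔ b) ⊓ c`, for all `a`, `b`, `c`. -/
def LatticeIsModular (L : Type*) [Lattice L] : Prop :=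
  ∀ a b c : L, a ≤ c → a ⊔ (b ⊓ c) = (a ⊔ b) ⊓ c

/-! Distributive lattices are modular, so the content is the converse. A congruence on `Inv(Γ)` is
determined by three kinds of pairs it contains (`le_of_basic`): `(u, 0)`, `(s(e), e e*)`, in which
case `e` is called an exit, and `(t, u)` with `t` a closed path at `u`. It therefore suffices to
move each such pair from `(a ⊔ b) ⊓ c` into `(a ⊓ c) ⊔ (b ⊓ c)`.

In `a ⊔ b`, a vertex becomes zero exactly when a path of exits of `a` or `b` leads to a vertex that
is zero in `a` or `b` (`sup_v_zero_iff`). At a vertex that stays nonzero there is at most one such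
exit, so paths of exits are determined by their length. There `a ⊔ b` adds no exits, and closed
paths are controlled by subgroups of `ℤ`, whose lattice is distributive.

The only obstruction is a vertex that becomes zero in `a ⊔ b` without being zero in `a` or `b`,
while `c` has a different exit there. Modularity excludes this (`no_fork`).

The argument uses only the relations and generation by the letters (`Rep`), never uniqueness of
normal forms. -/

/-- Subgroups of `ℤ` form a distributive lattice. -/
theorem AddSubgroup.int_sup_inf_le (A B C : AddSubgroup ℤ) :
    (A ⊔ B) ⊓ C ≤ (A ⊓ C) ⊔ (B ⊓ C) := by
  rintro x ⟨hx, hC⟩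
  obtain ⟨a, ha, b, hb, rfl⟩ := AddSubgroup.mem_sup.1 hx
  by_cases h0 : Int.gcd a b = 0
  · obtain ⟨rfl, rfl⟩ := Int.gcd_eq_zero_iff.1 h0
    simp
  obtain ⟨g, a', b', -, hco, rfl, rfl⟩ := Int.exists_gcd_one' (Nat.pos_of_ne_zero h0)
  obtain ⟨r, s, hrs⟩ := Int.isCoprime_iff_gcd_eq_one.2 hco
  -- With `x = (a' + b') g` and `r a' + s b' = 1`, split `x = r a' x + s b' x`; the summands are
  -- multiples of `x` and of `a' g`, respectively `b' g`.
  refine AddSubgroup.mem_sup.2 ⟨(r * (a' + b')) * (a' * g), ⟨?_, ?_⟩,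
    (s * (a' + b')) * (b' * g), ⟨?_, ?_⟩, ?_⟩
  · simpa using A.zsmul_mem ha (r * (a' + b'))
  · have := C.zsmul_mem hC (r * a')
    rw [smul_eq_mul] at this
    change _ ∈ C
    convert this using 1
    ring
  · simpa using B.zsmul_mem hb (s * (a' + b'))
  · have := C.zsmul_mem hC (s * b')
    rw [smul_eq_mul] at this
    change _ ∈ C
    convert this using 1
    ring
  · linear_combination ((a' + b') * g) * hrs

namespace DirectedGraph

/-! ### Paths in a directed graph -/

section Paths

variable {V : Type u} {E : Type v} (Γ : DirectedGraph V E)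

/-- `Γ.IsPath u l w`: the edges of `l`, in this order, form a path from `u` to `w`. -/
def IsPath : V → List E → V → Prop
  | u, [], w => u = w
  | u, e :: l, w => Γ.s e = u ∧ IsPath (Γ.r e) l w

variable {Γ}

@[simp] theorem isPath_nil {u w : V} : Γ.IsPath u [] w ↔ u = w := Iff.rfl

@[simp] theorem isPath_cons {u w : V} {e : E} {l : List E} :
    Γ.IsPath u (e :: l) w ↔ Γ.s e = u ∧ Γ.IsPath (Γ.r e) l w := Iff.rfl

theorem isPath_append {u w : V} {l m : List E} :
    Γ.IsPath u (l ++ m) w ↔ ∃ x, Γ.IsPath u l x ∧ Γ.IsPath x m w := by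
  induction l generalizing u with
  | nil => simp
  | cons e l ih => simp [ih, and_assoc]

theorem IsPath.append {u x w : V} {l m : List E} (hl : Γ.IsPath u l x) (hm : Γ.IsPath x m w) :
    Γ.IsPath u (l ++ m) w := isPath_append.2 ⟨x, hl, hm⟩

theorem IsPath.target_unique {u x w : V} {l : List E} (hl : Γ.IsPath u l x)
    (hm : Γ.IsPath u l w) : x = w := by
  induction l generalizing u with
  | nil => exact hl.symm.trans hm
  | cons e l ih => exact ih hl.2 hm.2

theorem IsPath.of_append {u x w : V} {l m : List E} (h : Γ.IsPath u (l ++ m) w)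
    (hl : Γ.IsPath u l x) : Γ.IsPath x m w := by
  obtain ⟨y, hy, hm⟩ := isPath_append.1 h
  rwa [hl.target_unique hy]

end Paths

/-! ### Generators and the normal form `p q*` -/

/-- A system of generators of a semigroup with zero `S` satisfying the relations of the graph
inverse semigroup of `Γ`. -/
structure Rep {V : Type u} {E : Type v} (Γ : DirectedGraph V E) (S : Type*)
    [SemigroupWithZero S] where
  /-- the vertices -/
  v : V → S
  /-- the edges -/
  e : E → S
  /-- the formal inverses of the edges -/
  t : E → S
  vert_self (a : V) : v a * v a = v a
  vert_ne (a b : V) (h : a ≠ b) : v a * v b = 0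
  source_edge (f : E) : v (Γ.s f) * e f = e f
  edge_range (f : E) : e f * v (Γ.r f) = e f
  range_star (f : E) : v (Γ.r f) * t f = t f
  star_source (f : E) : t f * v (Γ.s f) = t f
  star_edge_self (f : E) : t f * e f = v (Γ.r f)
  star_edge_ne (f g : E) (h : f ≠ g) : t f * e g = 0
  induction_on (P : S → Prop) (zero : P 0) (vert : ∀ a, P (v a)) (edge : ∀ f, P (e f))
    (star : ∀ f, P (t f)) (mul : ∀ x y, P x → P y → P (x * y)) : ∀ x, P x

namespace Rep

variable {V : Type u} {E : Type v} {Γ : DirectedGraph V E} {S : Type*} [SemigroupWithZero S]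
  (ι : Rep Γ S)

/-- The element of `S` given by the path `l` starting at `u`. -/
def path : V → List E → S
  | u, [] => ι.v u
  | _, f :: l => ι.e f * path (Γ.r f) l

/-- The element of `S` given by the formal inverse of the path `l` starting at `u`. -/
def star : V → List E → S
  | u, [] => ι.v u
  | _, f :: l => star (Γ.r f) l * ι.t f

@[simp] theorem path_nil (u : V) : ι.path u [] = ι.v u := rfl

@[simp] theorem path_cons (u : V) (f : E) (l : List E) :
    ι.path u (f :: l) = ι.e f * ι.path (Γ.r f) l := rfl

@[simp] theorem star_nil (u : V) : ι.star u [] = ι.v u := rfl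

@[simp] theorem star_cons (u : V) (f : E) (l : List E) :
    ι.star u (f :: l) = ι.star (Γ.r f) l * ι.t f := rfl

variable {u w x : V} {l m : List E}

theorem v_mul_path (h : Γ.IsPath u l w) : ι.v u * ι.path u l = ι.path u l := by
  cases l with
  | nil => exact ι.vert_self u
  | cons f l => rw [path_cons, ← mul_assoc, ← h.1, ι.source_edge]

theorem path_mul_v (h : Γ.IsPath u l w) : ι.path u l * ι.v w = ι.path u l := by
  induction l generalizing u with
  | nil => cases h; exact ι.vert_self _
  | cons f l ih => rw [path_cons, mul_assoc, ih h.2]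

theorem star_mul_v (h : Γ.IsPath u l w) : ι.star u l * ι.v u = ι.star u l := by
  cases l with
  | nil => exact ι.vert_self u
  | cons f l => rw [star_cons, mul_assoc, ← h.1, ι.star_source]

theorem v_mul_star (h : Γ.IsPath u l w) : ι.v w * ι.star u l = ι.star u l := by
  induction l generalizing u with
  | nil => cases h; exact ι.vert_self _
  | cons f l ih => rw [star_cons, ← mul_assoc, ih h.2]

theorem path_append (h : Γ.IsPath u l x) (hm : Γ.IsPath x m w) :
    ι.path u (l ++ m) = ι.path u l * ι.path x m := by
  induction l generalizing u with
  | nil => cases h; exact (ι.v_mul_path hm).symm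
  | cons f l ih => rw [List.cons_append, path_cons, ih h.2, path_cons, mul_assoc]

theorem star_append (h : Γ.IsPath u l x) (hm : Γ.IsPath x m w) :
    ι.star u (l ++ m) = ι.star x m * ι.star u l := by
  induction l generalizing u with
  | nil => cases h; exact (ι.star_mul_v hm).symm
  | cons f l ih => rw [List.cons_append, star_cons, ih h.2, star_cons, mul_assoc]

theorem t_mul_e_mul_path {f : E} (h : Γ.IsPath (Γ.r f) l w) :
    ι.t f * (ι.e f * ι.path (Γ.r f) l) = ι.path (Γ.r f) l := by
  rw [← mul_assoc, ι.star_edge_self, ι.v_mul_path h]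

theorem star_mul_path (h : Γ.IsPath u l w) : ι.star u l * ι.path u l = ι.v w := by
  induction l generalizing u with
  | nil => cases h; exact ι.vert_self _
  | cons f l ih => rw [star_cons, path_cons, mul_assoc, ι.t_mul_e_mul_path h.2, ih h.2]

/-- Incomparable paths part at edges `f ≠ g`, and there `f* g = 0`. -/
theorem path_prefix_or_star_mul_path_eq_zero (hl : Γ.IsPath u l w) (hm : Γ.IsPath u m x) :
    l <+: m ∨ m <+: l ∨ ι.star u l * ι.path u m = 0 := by
  induction l generalizing u m with
  | nil => simp
  | cons f l ih =>
    cases m with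
    | nil => simp
    | cons g m =>
      by_cases hfg : f = g
      · subst hfg
        rcases ih hl.2 hm.2 with h | h | h
        · exact .inl (List.cons_prefix_cons.2 ⟨rfl, h⟩)
        · exact .inr (.inl (List.cons_prefix_cons.2 ⟨rfl, h⟩))
        · refine .inr (.inr ?_)
          rw [star_cons, path_cons, mul_assoc, ι.t_mul_e_mul_path hm.2, h]
      · refine .inr (.inr ?_)
        rw [star_cons, path_cons, mul_assoc, ← mul_assoc (ι.t f), ι.star_edge_ne f g hfg,
          zero_mul, mul_zero]

/-- Elements of the form `p q*`, for paths `p` and `q` with a common target. -/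
def IsNormal (y : S) : Prop :=
  y = 0 ∨ ∃ a b w l m, Γ.IsPath a l w ∧ Γ.IsPath b m w ∧ y = ι.path a l * ι.star b m

theorem isNormal_v_mul {y : S} (hy : ι.IsNormal y) (c : V) : ι.IsNormal (ι.v c * y) := by
  obtain rfl | ⟨a, b, w, l, m, hl, hm, rfl⟩ := hy
  · exact .inl (mul_zero _)
  · by_cases h : c = a
    · subst h
      exact .inr ⟨c, b, w, l, m, hl, hm, by rw [← mul_assoc, ι.v_mul_path hl]⟩
    · left
      rw [← ι.v_mul_path hl, ← mul_assoc, ← mul_assoc, ι.vert_ne c a h, zero_mul, zero_mul]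

theorem isNormal_e_mul {y : S} (hy : ι.IsNormal y) (f : E) : ι.IsNormal (ι.e f * y) := by
  obtain rfl | ⟨a, b, w, l, m, hl, hm, rfl⟩ := hy
  · exact .inl (mul_zero _)
  · by_cases h : Γ.r f = a
    · subst h
      exact .inr ⟨Γ.s f, b, w, f :: l, m, ⟨rfl, hl⟩, hm, by rw [path_cons, mul_assoc]⟩
    · left
      rw [← ι.v_mul_path hl, ← ι.edge_range, mul_assoc, ← mul_assoc (ι.v _), ← mul_assoc (ι.v _),
        ι.vert_ne _ a h, zero_mul, zero_mul, mul_zero]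

theorem isNormal_t_mul {y : S} (hy : ι.IsNormal y) (f : E) : ι.IsNormal (ι.t f * y) := by
  obtain rfl | ⟨a, b, w, l, m, hl, hm, rfl⟩ := hy
  · exact .inl (mul_zero _)
  · cases l with
    | nil =>
      cases hl
      by_cases h : Γ.s f = a
      · subst h
        have hf : Γ.IsPath (Γ.s f) [f] (Γ.r f) := ⟨rfl, rfl⟩
        refine .inr ⟨Γ.r f, b, Γ.r f, [], m ++ [f], rfl, hm.append hf, ?_⟩
        rw [ι.star_append hm hf, path_nil, path_nil, star_cons, star_nil, ι.range_star,
          ← mul_assoc, ι.star_source, ← mul_assoc, ι.range_star]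
      · left
        rw [path_nil, ← ι.star_source, mul_assoc, ← mul_assoc (ι.v _), ι.vert_ne _ a h, zero_mul,
          mul_zero]
    | cons g l =>
      by_cases h : f = g
      · subst h
        exact .inr ⟨Γ.r f, b, w, l, m, hl.2, hm, by
          rw [path_cons, ← mul_assoc, ι.t_mul_e_mul_path hl.2]⟩
      · left
        rw [path_cons, mul_assoc, ← mul_assoc, ι.star_edge_ne f g h, zero_mul]

theorem isNormal (y : S) : ι.IsNormal y := by
  -- Elements arise as arbitrary products, so the induction must also carry stability of normal
  -- forms under left multiplication.
  suffices H : ∀ x, ι.IsNormal x ∧ ∀ y, ι.IsNormal y → ι.IsNormal (x * y) from (H y).1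
  refine ι.induction_on _ ?_ ?_ ?_ ?_ ?_
  · exact ⟨.inl rfl, fun y _ => .inl (zero_mul y)⟩
  · exact fun a => ⟨.inr ⟨a, a, a, [], [], rfl, rfl, (ι.vert_self a).symm⟩,
      fun y hy => ι.isNormal_v_mul hy a⟩
  · refine fun f => ⟨.inr ⟨Γ.s f, Γ.r f, Γ.r f, [f], [], ⟨rfl, rfl⟩, rfl, ?_⟩,
      fun y hy => ι.isNormal_e_mul hy f⟩
    simp [ι.edge_range]
  · refine fun f => ⟨.inr ⟨Γ.r f, Γ.s f, Γ.r f, [], [f], rfl, ⟨rfl, rfl⟩, ?_⟩,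
      fun y hy => ι.isNormal_t_mul hy f⟩
    simp [ι.range_star]
  · intro x y hx hy
    refine ⟨hx.2 y hy.1, fun z hz => ?_⟩
    rw [mul_assoc]
    exact hx.2 _ (hy.2 _ hz)

end Rep
end DirectedGraph

/-! ### Congruences and their generating pairs -/

theorem Con.rel_mul_left {M : Type*} [Mul M] (c : Con M) {x y : M} (z : M) (h : c x y) :
    c (z * x) (z * y) := c.mul (c.refl z) h

theorem Con.rel_mul_right {M : Type*} [Mul M] (c : Con M) {x y : M} (z : M) (h : c x y) :
    c (x * z) (y * z) := c.mul h (c.refl z)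

namespace DirectedGraph.Rep

variable {V : Type u} {E : Type v} {Γ : DirectedGraph V E} {S : Type*} [SemigroupWithZero S]
  (ι : Rep Γ S) {u w x : V} {l m : List E} {ρ τ : Con S}

theorem path_mul_star_path (h : Γ.IsPath u l w) :
    ι.path u l * (ι.star u l * ι.path u l) = ι.path u l := by
  rw [ι.star_mul_path h, ι.path_mul_v h]

theorem rel_v_zero_of_path_mul_star (hl : Γ.IsPath u l w) (hm : Γ.IsPath x m w)
    (h : ρ (ι.path u l * ι.star x m) 0) : ρ (ι.v w) 0 := by
  have := ρ.rel_mul_right (ι.path x m) (ρ.rel_mul_left (ι.star u l) h)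
  rwa [← mul_assoc, ι.star_mul_path hl, mul_assoc, ι.star_mul_path hm, ι.vert_self, mul_zero,
    zero_mul] at this

theorem rel_v_zero_of_path (hl : Γ.IsPath u l w) (h : ρ (ι.path u l) 0) : ρ (ι.v w) 0 := by
  refine ι.rel_v_zero_of_path_mul_star (x := w) (m := []) hl rfl ?_
  rwa [star_nil, ι.path_mul_v hl]

theorem rel_v_zero_of_star (hl : Γ.IsPath u l w) (h : ρ (ι.star u l) 0) : ρ (ι.v w) 0 := by
  refine ι.rel_v_zero_of_path_mul_star (u := w) (l := []) rfl hl ?_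
  rwa [path_nil, ι.v_mul_star hl]

theorem rel_path_zero (hl : Γ.IsPath u l w) (h : ρ (ι.v w) 0) : ρ (ι.path u l) 0 := by
  have := ρ.rel_mul_left (ι.path u l) h
  rwa [ι.path_mul_v hl, mul_zero] at this

theorem rel_path_zero_of_source (hl : Γ.IsPath u l w) (h : ρ (ι.v u) 0) : ρ (ι.path u l) 0 := by
  have := ρ.rel_mul_right (ι.path u l) h
  rwa [ι.v_mul_path hl, zero_mul] at this

theorem rel_v_zero_of_source (hl : Γ.IsPath u l w) (h : ρ (ι.v u) 0) : ρ (ι.v w) 0 :=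
  ι.rel_v_zero_of_path hl (ι.rel_path_zero_of_source hl h)

/-- The congruence `ρ` identifies `e e*` with the source of `e`. -/
def Exit (ρ : Con S) (f : E) : Prop := ρ (ι.v (Γ.s f)) (ι.e f * ι.t f)

theorem rel_range_zero_iff {f : E} : ρ (ι.v (Γ.r f)) 0 ↔ ρ (ι.e f) 0 := by
  constructor
  · intro h
    have := ρ.rel_mul_left (ι.e f) h
    rwa [ι.edge_range, mul_zero] at this
  · intro h
    have := ρ.rel_mul_left (ι.t f) h
    rwa [ι.star_edge_self, mul_zero] at this

theorem exit_of_source_zero {f : E} (h : ρ (ι.v (Γ.s f)) 0) : ι.Exit ρ f := by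
  have := ρ.rel_mul_right (ι.e f * ι.t f) h
  rw [← mul_assoc, ι.source_edge, zero_mul] at this
  exact ρ.trans h (ρ.symm this)

theorem exit_of_zero {f : E} (h : ρ (ι.v (Γ.s f)) 0) (h' : ρ (ι.v (Γ.r f)) 0) : ι.Exit ρ f := by
  have := ρ.rel_mul_right (ι.t f) (ι.rel_range_zero_iff.1 h')
  rw [zero_mul] at this
  exact ρ.trans h (ρ.symm this)

theorem Exit.source_zero {ι : Rep Γ S} {f : E} (hf : ι.Exit ρ f) (h : ρ (ι.v (Γ.r f)) 0) :
    ρ (ι.v (Γ.s f)) 0 := by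
  have := ρ.rel_mul_right (ι.t f) (ι.rel_range_zero_iff.1 h)
  rw [zero_mul] at this
  exact ρ.trans hf this

/-- Multiply `s(f) ~ f f*` on the right by `g` and use `f* g = 0`: an exit kills the range of every
competing edge. -/
theorem Exit.range_zero {ι : Rep Γ S} {f g : E} (hf : ι.Exit ρ f) (hs : Γ.s f = Γ.s g)
    (hfg : f ≠ g) : ρ (ι.v (Γ.r g)) 0 := by
  have := ρ.rel_mul_right (ι.e g) hf
  rw [hs, ι.source_edge, mul_assoc, ι.star_edge_ne f g hfg, mul_zero] at this
  exact ι.rel_range_zero_iff.2 this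

theorem Exit.eq_or_zero {ι : Rep Γ S} {f g : E} (hf : ι.Exit ρ f) (hg : ι.Exit ρ g)
    (hs : Γ.s f = Γ.s g) : f = g ∨ ρ (ι.v (Γ.s f)) 0 := by
  by_cases hfg : f = g
  · exact .inl hfg
  · exact .inr (hs ▸ hg.source_zero (hf.range_zero hs hfg))

/-- If `s(f)` is congruent to a multiple `f y`, then it is congruent to `f f*`. -/
theorem exit_of_rel {f : E} {y : S} (h : ρ (ι.v (Γ.s f)) (ι.e f * y)) : ι.Exit ρ f := by
  -- Left multiplication by `f f*` fixes `f y` and turns `s(f)` into `f f*`.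
  have h1 := ρ.rel_mul_left (ι.e f * ι.t f) h
  rw [mul_assoc, ι.star_source, mul_assoc, ← mul_assoc (ι.t f), ι.star_edge_self, ← mul_assoc,
    ι.edge_range] at h1
  exact ρ.trans h (ρ.symm h1)

theorem exit_of_rel' {f : E} {y : S} (h : ρ (ι.v (Γ.s f)) (y * ι.t f)) : ι.Exit ρ f := by
  have h1 := ρ.rel_mul_right (ι.e f * ι.t f) h
  rw [← mul_assoc, ι.source_edge, mul_assoc, ← mul_assoc (ι.t f), ι.star_edge_self,
    ι.range_star] at h1
  exact ρ.trans h (ρ.symm h1)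

section Generation

variable (hW : ∀ f, ι.Exit ρ f → ι.Exit τ f)
  (hC : ∀ u l, Γ.IsPath u l u → ρ (ι.path u l) (ι.v u) → τ (ι.path u l) (ι.v u))

-- Conjugation by the first edge `f` peels it off, and `f` itself is an exit by `exit_of_rel`; hence
-- every edge of the path is an exit.
include hW in
theorem rel_path_mul_star_of_exit (hl : Γ.IsPath u l w)
    (h : ρ (ι.v u) (ι.path u l * ι.star u l)) : τ (ι.v u) (ι.path u l * ι.star u l) := by
  induction l generalizing u with
  | nil => rw [path_nil, star_nil, ι.vert_self]; exact τ.refl _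
  | cons f l ih =>
    obtain ⟨rfl, hl⟩ := hl
    rw [path_cons, star_cons, mul_assoc] at h
    have h1 := ρ.rel_mul_right (ι.e f) (ρ.rel_mul_left (ι.t f) h)
    rw [ι.star_source, ι.star_edge_self, ← mul_assoc (ι.t f), ι.star_edge_self, ← mul_assoc,
      ι.v_mul_path hl, mul_assoc, mul_assoc, ι.star_edge_self, ι.star_mul_v hl] at h1
    have h2 := τ.rel_mul_right (ι.t f) (τ.rel_mul_left (ι.e f) (ih hl h1))
    rw [ι.edge_range] at h2
    refine τ.trans (hW f (ι.exit_of_rel h)) ?_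
    simpa only [path_cons, star_cons, mul_assoc] using h2

-- Unless `w` is zero, one path extends the other by a closed path `k` at `w`, and the relation
-- reduces to `k ~ w`.
include hC in
theorem rel_star_of_closed (hl : Γ.IsPath u l w) (hm : Γ.IsPath u m w)
    (h0 : ¬ ρ (ι.v w) 0) (h : ρ (ι.star u l) (ι.star u m)) : τ (ι.star u l) (ι.star u m) := by
  have key : ∀ l k, Γ.IsPath u l w → Γ.IsPath u (l ++ k) w → ρ (ι.star u l) (ι.star u (l ++ k)) →
      τ (ι.star u l) (ι.star u (l ++ k)) := by
    intro l k hl hm h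
    have hk := hm.of_append hl
    rw [ι.star_append hl hk] at h ⊢
    have h1 := ρ.rel_mul_right (ι.path u l) h
    rw [mul_assoc, ι.star_mul_path hl, ι.star_mul_v hk] at h1
    have h2 := ρ.rel_mul_right (ι.path w k) h1
    rw [ι.star_mul_path hk, ι.v_mul_path hk] at h2
    have h3 := τ.rel_mul_left (ι.star w k) (hC w k hk h2)
    rw [ι.star_mul_path hk, ι.star_mul_v hk] at h3
    have h4 := τ.rel_mul_right (ι.star u l) h3
    rwa [ι.v_mul_star hl] at h4
  rcases ι.path_prefix_or_star_mul_path_eq_zero hl hm with ⟨k, rfl⟩ | ⟨k, rfl⟩ | h1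
  · exact key _ _ hl hm h
  · exact τ.symm (key _ _ hm hl (ρ.symm h))
  · have h2 := ρ.rel_mul_right (ι.path u m) h
    rw [h1, ι.star_mul_path hm] at h2
    exact absurd (ρ.symm h2) h0

-- Write `p`, `q` for the paths `l`, `m`. Cancelling `p` gives `q* ~ k n*`, whence `w ~ k k*` and
-- `(q k)* ~ n*`. Both transfer to `τ`, and `p q* ~ p k k* q* = p k (q k)* ~ p k n*`.
include hW hC in
theorem rel_of_append {a b : V} {k : List E} (hl : Γ.IsPath a l w) (hm : Γ.IsPath b m w)
    {n : List E} (hk : Γ.IsPath w k x) (hn : Γ.IsPath b n x) (h0 : ¬ ρ (ι.v w) 0)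
    (h : ρ (ι.path a l * ι.star b m) (ι.path a (l ++ k) * ι.star b n)) :
    τ (ι.path a l * ι.star b m) (ι.path a (l ++ k) * ι.star b n) := by
  have hx : ¬ ρ (ι.v x) 0 := fun h1 => h0 <| by
    refine ι.rel_v_zero_of_path_mul_star hl hm (ρ.trans h ?_)
    have := ρ.rel_mul_right (ι.star b n) (ι.rel_path_zero (hl.append hk) h1)
    rwa [zero_mul] at this
  rw [ι.path_append hl hk] at h ⊢
  have h1 := ρ.rel_mul_left (ι.star a l) h
  rw [← mul_assoc, ι.star_mul_path hl, ι.v_mul_star hm, ← mul_assoc, ← mul_assoc,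
    ι.star_mul_path hl, ι.v_mul_path hk] at h1
  have h2 := ρ.rel_mul_left (ι.star w k) h1
  rw [← mul_assoc (ι.star w k), ι.star_mul_path hk, ι.v_mul_star hn, ← ι.star_append hm hk] at h2
  have h3 := ρ.rel_mul_right (ι.path b m) h1
  rw [ι.star_mul_path hm] at h3
  have h4 := ρ.rel_mul_left (ι.path w k * ι.star w k) h3
  have e1 : ι.path w k * ι.star w k * (ι.path w k * ι.star b n * ι.path b m)
      = ι.path w k * ι.star b n * ι.path b m := by
    simp only [← mul_assoc]
    rw [mul_assoc (ι.path w k), ι.path_mul_star_path hk]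
  rw [e1, mul_assoc, ι.star_mul_v hk] at h4
  have h5 := ι.rel_path_mul_star_of_exit hW hk (ρ.trans h3 (ρ.symm h4))
  have h6 := ι.rel_star_of_closed hC (hm.append hk) hn hx h2
  have h7 := τ.rel_mul_right (ι.star b m) (τ.rel_mul_left (ι.path a l) h5)
  rw [ι.path_mul_v hl] at h7
  refine τ.trans h7 ?_
  have h8 := τ.rel_mul_left (ι.path a l * ι.path w k) h6
  rw [ι.star_append hm hk] at h8
  simpa only [mul_assoc] using h8

include hW hC in
/-- A congruence is generated by the pairs `(v, 0)`, `(s(e), e e*)` and `(c, v)`, where `c` is a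
closed path at `v`, which it contains. -/
theorem le_of_basic (hH : ∀ u, ρ (ι.v u) 0 → τ (ι.v u) 0) : ρ ≤ τ := by
  have hzero : ∀ y, ρ y 0 → τ y 0 := by
    intro y hy
    obtain rfl | ⟨a, b, w, l, m, hl, hm, rfl⟩ := ι.isNormal y
    · exact τ.refl 0
    · have := τ.rel_mul_right (ι.star b m)
        (ι.rel_path_zero hl (hH w (ι.rel_v_zero_of_path_mul_star hl hm hy)))
      rwa [zero_mul] at this
  intro y z h
  by_cases hy : ρ y 0
  · exact τ.trans (hzero y hy) (τ.symm (hzero z (ρ.trans (ρ.symm h) hy)))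
  have hz : ¬ ρ z 0 := fun hz => hy (ρ.trans h hz)
  obtain rfl | ⟨a, b, w, l, m, hl, hm, rfl⟩ := ι.isNormal y
  · exact absurd (ρ.refl 0) hy
  obtain rfl | ⟨a', b', w', l', m', hl', hm', rfl⟩ := ι.isNormal z
  · exact absurd (ρ.refl 0) hz
  have hw : ¬ ρ (ι.v w) 0 := fun h1 => hy <| by
    have := ρ.rel_mul_right (ι.star b m) (ι.rel_path_zero hl h1)
    rwa [zero_mul] at this
  have hw' : ¬ ρ (ι.v w') 0 := fun h1 => hz <| by
    have := ρ.rel_mul_right (ι.star b' m') (ι.rel_path_zero hl' h1)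
    rwa [zero_mul] at this
  obtain rfl : a = a' := by
    by_contra hne
    have := ρ.rel_mul_left (ι.v a) h
    rw [← mul_assoc, ι.v_mul_path hl, ← ι.v_mul_path hl', ← mul_assoc, ← mul_assoc,
      ι.vert_ne a a' hne, zero_mul, zero_mul] at this
    exact hy this
  obtain rfl : b = b' := by
    by_contra hne
    have := ρ.rel_mul_right (ι.v b) h
    rw [mul_assoc, ι.star_mul_v hm, ← ι.star_mul_v hm', mul_assoc, mul_assoc,
      ι.vert_ne b' b (Ne.symm hne), mul_zero, mul_zero] at this
    exact hy this
  rcases ι.path_prefix_or_star_mul_path_eq_zero hl hl' with ⟨k, rfl⟩ | ⟨k, rfl⟩ | h1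
  · exact ι.rel_of_append hW hC hl hm (hl'.of_append hl) hm' hw h
  · exact τ.symm (ι.rel_of_append hW hC hl' hm' (hl.of_append hl') hm hw' (ρ.symm h))
  · have h2 := ρ.rel_mul_left (ι.star a l) h
    rw [← mul_assoc, ι.star_mul_path hl, ι.v_mul_star hm, ← mul_assoc, h1, zero_mul] at h2
    exact absurd (ι.rel_v_zero_of_star hm h2) hw

end Generation

end DirectedGraph.Rep

/-! ### Vertices and paths modulo a join of two congruences -/

/-- Induction along the chains of `a`-steps and `b`-steps that make up `a ⊔ b`. -/
theorem Con.sup_induction {M : Type*} [Mul M] {a b : Con M} {P : M → Prop} {x y : M}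
    (h : (a ⊔ b) x y) (hx : P x)
    (step : ∀ c, c = a ∨ c = b → ∀ y z, c y z → P y → P z) : P y := by
  let r : M → M → Prop := fun x y => ∃ c, (c = a ∨ c = b) ∧ c x y
  let d : Con M :=
    { r := Relation.ReflTransGen r
      iseqv := ⟨fun _ => .refl, fun h => by
        induction h with
        | refl => exact .refl
        | tail _ h ih =>
          obtain ⟨c, hc, h⟩ := h
          exact .head ⟨c, hc, c.symm h⟩ ih, fun h h' => h.trans h'⟩
      mul' := fun {w x y z} h h' => by
        refine Relation.ReflTransGen.trans (b := x * y) ?_ ?_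
        · exact h.lift (· * y) fun _ _ ⟨c, hc, h⟩ => ⟨c, hc, c.rel_mul_right _ h⟩
        · exact h'.lift (x * ·) fun _ _ ⟨c, hc, h⟩ => ⟨c, hc, c.rel_mul_left _ h⟩ }
  have hd : a ⊔ b ≤ d := sup_le (fun _ _ h => .single ⟨a, .inl rfl, h⟩)
    (fun _ _ h => .single ⟨b, .inr rfl, h⟩)
  have h1 : Relation.ReflTransGen r x y := hd h
  clear h hd
  induction h1 with
  | refl => exact hx
  | tail _ h ih =>
    obtain ⟨c, hc, h⟩ := h
    exact step c hc _ _ h ih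

namespace DirectedGraph.Rep

variable {V : Type u} {E : Type v} {Γ : DirectedGraph V E} {S : Type*} [SemigroupWithZero S]
  (ι : Rep Γ S)

/-- The vertices from which a path of edges `e` identified with their source vertex by `a` or `b`
(in the sense of `Exit`) leads to a vertex that is zero modulo `a` or `b`. -/
inductive JoinZero (a b : Con S) : V → Prop
  | base (u : V) (h : a (ι.v u) 0 ∨ b (ι.v u) 0) : JoinZero a b u
  | step (f : E) (h : ι.Exit a f ∨ ι.Exit b f) (h' : JoinZero a b (Γ.r f)) :
    JoinZero a b (Γ.s f)

/-- A path all of whose edges are identified with their source vertex by `a` or `b`. -/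
def JoinPath (a b : Con S) (u : V) (l : List E) (w : V) : Prop :=
  Γ.IsPath u l w ∧ ∀ f ∈ l, ι.Exit a f ∨ ι.Exit b f

variable {ι} {a b c : Con S} {u w x : V} {l m : List E}

theorem JoinZero.of_rel (hc : c = a ∨ c = b) (h : c (ι.v u) 0) : ι.JoinZero a b u := by
  rcases hc with rfl | rfl
  · exact .base u (.inl h)
  · exact .base u (.inr h)

theorem joinEdge_of_exit {f : E} (hc : c = a ∨ c = b) (h : ι.Exit c f) :
    ι.Exit a f ∨ ι.Exit b f := by
  rcases hc with rfl | rfl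
  · exact .inl h
  · exact .inr h

theorem joinEdge_unique {f g : E} (hf : ι.Exit a f ∨ ι.Exit b f) (hg : ι.Exit a g ∨ ι.Exit b g)
    (hs : Γ.s f = Γ.s g) (h0 : ¬ ι.JoinZero a b (Γ.s f)) : f = g := by
  by_contra hfg
  refine h0 (hs ▸ .step g hg (.base _ ?_))
  exact hf.imp (fun h => h.range_zero hs hfg) (fun h => h.range_zero hs hfg)

theorem joinPath_nil : ι.JoinPath a b u [] u := ⟨rfl, by simp⟩

theorem joinPath_cons {f : E} : ι.JoinPath a b u (f :: l) w ↔
    Γ.s f = u ∧ (ι.Exit a f ∨ ι.Exit b f) ∧ ι.JoinPath a b (Γ.r f) l w := by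
  simp only [JoinPath, isPath_cons, List.forall_mem_cons]
  tauto

theorem JoinPath.append (hl : ι.JoinPath a b u l x) (hm : ι.JoinPath a b x m w) :
    ι.JoinPath a b u (l ++ m) w :=
  ⟨hl.1.append hm.1, by
    intro f hf
    exact (List.mem_append.1 hf).elim (hl.2 f) (hm.2 f)⟩

theorem JoinPath.of_append (h : ι.JoinPath a b u (l ++ m) w) (hl : ι.JoinPath a b u l x) :
    ι.JoinPath a b x m w :=
  ⟨h.1.of_append hl.1, fun f hf => h.2 f (List.mem_append_right _ hf)⟩

theorem JoinPath.not_joinZero (hl : ι.JoinPath a b u l w) (hu : ¬ ι.JoinZero a b u) :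
    ¬ ι.JoinZero a b w := by
  induction l generalizing u with
  | nil => exact hl.1 ▸ hu
  | cons f l ih =>
    obtain ⟨rfl, hf, hl⟩ := joinPath_cons.1 hl
    exact ih hl fun h => hu (.step f hf h)

/-- By `joinEdge_unique` each vertex reached has at most one exit, so the join paths from `u` form a
chain. -/
theorem JoinPath.prefix_of_length_le (hu : ¬ ι.JoinZero a b u) (hl : ι.JoinPath a b u l w)
    (hm : ι.JoinPath a b u m x) (h : l.length ≤ m.length) : l <+: m := by
  induction l generalizing u m with
  | nil => exact List.nil_prefix
  | cons f l ih =>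
    cases m with
    | nil => simp at h
    | cons g m =>
      obtain ⟨rfl, hf, hl⟩ := joinPath_cons.1 hl
      obtain ⟨hs, hg, hm⟩ := joinPath_cons.1 hm
      obtain rfl := joinEdge_unique hf hg hs.symm hu
      exact List.cons_prefix_cons.2
        ⟨rfl, ih (fun h => hu (.step f hf h)) hl hm (by simpa using h)⟩

theorem JoinPath.eq_of_length_eq (hu : ¬ ι.JoinZero a b u) (hl : ι.JoinPath a b u l w)
    (hm : ι.JoinPath a b u m x) (h : l.length = m.length) : l = m :=
  (hl.prefix_of_length_le hu hm h.le).eq_of_length h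

theorem not_rel_of_not_joinZero (hc : c = a ∨ c = b) (hu : ¬ ι.JoinZero a b u) :
    ¬ c (ι.v u) 0 := fun h => hu (.of_rel hc h)

theorem joinPath_of_rel_path (hc : c = a ∨ c = b) (hu : ¬ ι.JoinZero a b u)
    (hl : ι.JoinPath a b u l w) (hm : Γ.IsPath u m x) {y : S}
    (h : c (ι.path u l) (ι.path u m * y)) : ι.JoinPath a b u m x := by
  induction m generalizing u w l y with
  | nil => exact ⟨hm, by simp⟩
  | cons f m ih =>
    obtain ⟨rfl, hm⟩ := hm
    have e1 : ι.t f * (ι.path (Γ.s f) (f :: m) * y) = ι.path (Γ.r f) m * y := by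
      rw [path_cons, ← mul_assoc, ι.t_mul_e_mul_path hm]
    cases l with
    | nil =>
      rw [path_nil, path_cons, mul_assoc] at h
      have hf := joinEdge_of_exit hc (ι.exit_of_rel h)
      refine joinPath_cons.2 ⟨rfl, hf, ih (fun h => hu (.step f hf h)) joinPath_nil hm
        (y := y * ι.e f) ?_⟩
      have := c.rel_mul_right (ι.e f) (c.rel_mul_left (ι.t f) h)
      rw [ι.star_source, ι.star_edge_self, ← mul_assoc (ι.e f), ← mul_assoc (ι.t f),
        ι.t_mul_e_mul_path hm, mul_assoc] at this
      exact this
    | cons g l =>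
      obtain ⟨hs, hg, hl'⟩ := joinPath_cons.1 hl
      by_cases hfg : g = f
      · subst hfg
        have h1 := c.rel_mul_left (ι.t g) h
        rw [e1, path_cons, ι.t_mul_e_mul_path hl'.1] at h1
        exact joinPath_cons.2 ⟨rfl, hg, ih (fun h => hu (.step g hg h)) hl' hm h1⟩
      · have h1 := c.rel_mul_left (ι.t g) h
        rw [path_cons, ι.t_mul_e_mul_path hl'.1, path_cons, mul_assoc, ← mul_assoc (ι.t g),
          ι.star_edge_ne g f hfg, zero_mul] at h1
        refine absurd (ι.rel_v_zero_of_path hl'.1 h1) (not_rel_of_not_joinZero hc ?_)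
        exact hl'.not_joinZero fun h => hu (hs ▸ .step g hg h)

theorem joinPath_of_rel_star (hc : c = a ∨ c = b) (hu : ¬ ι.JoinZero a b u)
    (hl : ι.JoinPath a b u l w) (hm : Γ.IsPath u m x) {y : S}
    (h : c (ι.star u l) (y * ι.star u m)) : ι.JoinPath a b u m x := by
  induction m generalizing u w l y with
  | nil => exact ⟨hm, by simp⟩
  | cons f m ih =>
    obtain ⟨rfl, hm⟩ := hm
    have e0 : ∀ l w, Γ.IsPath (Γ.r f) l w → ι.star (Γ.r f) l * ι.t f * ι.e f =
        ι.star (Γ.r f) l := by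
      intro l w hl
      rw [mul_assoc, ι.star_edge_self, ι.star_mul_v hl]
    cases l with
    | nil =>
      rw [star_nil, star_cons, ← mul_assoc] at h
      have hf := joinEdge_of_exit hc (ι.exit_of_rel' h)
      refine joinPath_cons.2 ⟨rfl, hf, ih (fun h => hu (.step f hf h)) joinPath_nil hm
        (y := ι.t f * y) ?_⟩
      have := c.rel_mul_right (ι.e f) (c.rel_mul_left (ι.t f) h)
      rw [ι.star_source, ι.star_edge_self, mul_assoc, mul_assoc, mul_assoc, ι.star_edge_self,
        ι.star_mul_v hm, ← mul_assoc] at this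
      exact this
    | cons g l =>
      obtain ⟨hs, hg, hl'⟩ := joinPath_cons.1 hl
      have h1 := c.rel_mul_right (ι.e g) h
      by_cases hfg : f = g
      · subst hfg
        rw [star_cons, e0 l w hl'.1, star_cons, mul_assoc y, e0 m x hm] at h1
        exact joinPath_cons.2 ⟨rfl, hg, ih (fun h => hu (.step f hg h)) hl' hm h1⟩
      · rw [star_cons, mul_assoc, ι.star_edge_self, ι.star_mul_v hl'.1, star_cons, mul_assoc,
          mul_assoc, ι.star_edge_ne f g hfg, mul_zero, mul_zero] at h1
        refine absurd (ι.rel_v_zero_of_star hl'.1 h1) (not_rel_of_not_joinZero hc ?_)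
        exact hl'.not_joinZero fun h => hu (hs ▸ .step g hg h)

/-- The invariant of chains for `a ⊔ b`: a single `a`-step or `b`-step keeps both paths among the
join paths at `u`. -/
theorem joinPath_of_rel {p q : V} {l' m' : List E} (hc : c = a ∨ c = b)
    (hu : ¬ ι.JoinZero a b u) (hl : ι.JoinPath a b u l w) (hm : ι.JoinPath a b u m w)
    (hl' : Γ.IsPath p l' x) (hm' : Γ.IsPath q m' x)
    (h : c (ι.path u l * ι.star u m) (ι.path p l' * ι.star q m')) :
    p = u ∧ q = u ∧ ι.JoinPath a b u l' x ∧ ι.JoinPath a b u m' x := by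
  have hy : ¬ c (ι.path u l * ι.star u m) 0 := fun hy =>
    not_rel_of_not_joinZero hc (hl.not_joinZero hu)
      (ι.rel_v_zero_of_path_mul_star hl.1 hm.1 hy)
  obtain rfl : u = p := by
    by_contra hne
    have := c.rel_mul_left (ι.v u) h
    rw [← mul_assoc, ι.v_mul_path hl.1, ← ι.v_mul_path hl', ← mul_assoc, ← mul_assoc,
      ι.vert_ne u p hne, zero_mul, zero_mul] at this
    exact hy this
  obtain rfl : u = q := by
    by_contra hne
    have := c.rel_mul_right (ι.v u) h
    rw [mul_assoc, ι.star_mul_v hm.1, ← ι.star_mul_v hm', mul_assoc, mul_assoc,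
      ι.vert_ne q u (Ne.symm hne), mul_zero, mul_zero] at this
    exact hy this
  refine ⟨rfl, rfl, ?_, ?_⟩
  · have := c.rel_mul_right (ι.path u m) h
    rw [mul_assoc, ι.star_mul_path hm.1, ι.path_mul_v hl.1, mul_assoc] at this
    exact joinPath_of_rel_path hc hu hl hl' this
  · have := c.rel_mul_left (ι.star u l) h
    rw [← mul_assoc, ι.star_mul_path hl.1, ι.v_mul_star hm.1, ← mul_assoc] at this
    exact joinPath_of_rel_star hc hu hm hm' this

/-! ### Closed paths and subgroups of `ℤ` -/

variable (ι) in
/-- The differences of the lengths of closed join paths at `u` that are congruent modulo `c`. -/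
def shifts (a b : Con S) (u : V) (c : Con S) : AddSubgroup ℤ where
  carrier := {k | ∃ l m, ι.JoinPath a b u l u ∧ ι.JoinPath a b u m u ∧
    c (ι.path u l) (ι.path u m) ∧ k = (l.length : ℤ) - m.length}
  zero_mem' := ⟨[], [], joinPath_nil, joinPath_nil, c.refl _, by simp⟩
  add_mem' := by
    rintro _ _ ⟨l, m, hl, hm, h, rfl⟩ ⟨l', m', hl', hm', h', rfl⟩
    refine ⟨l ++ l', m ++ m', hl.append hl', hm.append hm', ?_, ?_⟩
    · rw [ι.path_append hl.1 hl'.1, ι.path_append hm.1 hm'.1]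
      exact c.mul h h'
    · push_cast [List.length_append]
      ring
  neg_mem' := by
    rintro _ ⟨l, m, hl, hm, h, rfl⟩
    exact ⟨m, l, hm, hl, c.symm h, by ring⟩

theorem shifts_mono {c d : Con S} (h : c ≤ d) : ι.shifts a b u c ≤ ι.shifts a b u d := by
  rintro _ ⟨l, m, hl, hm, h', rfl⟩
  exact ⟨l, m, hl, hm, h h', rfl⟩

theorem shifts_inf_le {c d : Con S} (hu : ¬ ι.JoinZero a b u) :
    ι.shifts a b u c ⊓ ι.shifts a b u d ≤ ι.shifts a b u (c ⊓ d) := by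
  rintro _ ⟨⟨l, m, hl, hm, h, rfl⟩, ⟨l', m', hl', hm', h', hk⟩⟩
  -- Equal differences make `m ++ l'` and `l ++ m'` equally long, hence equal; so this one pair is
  -- congruent modulo both `c` and `d`.
  refine ⟨l ++ l', m ++ l', hl.append hl', hm.append hl', Con.inf_iff_and.2 ⟨?_, ?_⟩, ?_⟩
  · rw [ι.path_append hl.1 hl'.1, ι.path_append hm.1 hl'.1]
    exact c.rel_mul_right _ h
  · rw [(hm.append hl').eq_of_length_eq hu (hl.append hm')
      (by simp only [List.length_append]; omega), ι.path_append hl.1 hl'.1, ι.path_append hl.1 hm'.1]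
    exact d.rel_mul_left _ h'
  · push_cast [List.length_append]
    ring

/-- A high power of `t` is longer than `l`, so `l` is a prefix of it and the remainder returns to
`u`. -/
theorem exists_return_path {t : List E} (hu : ¬ ι.JoinZero a b u) (ht : ι.JoinPath a b u t u)
    (ht0 : t ≠ []) (hl : ι.JoinPath a b u l w) : ∃ g, ι.JoinPath a b w g u := by
  have H : ∀ n, ∃ T, ι.JoinPath a b u T u ∧ n ≤ T.length := by
    intro n
    induction n with
    | zero => exact ⟨[], joinPath_nil, Nat.zero_le _⟩
    | succ n ih =>
      obtain ⟨T, hT, hn⟩ := ih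
      refine ⟨t ++ T, ht.append hT, ?_⟩
      have := List.length_pos_iff.2 ht0
      rw [List.length_append]
      omega
  obtain ⟨T, hT, hn⟩ := H l.length
  obtain ⟨g, rfl⟩ := hl.prefix_of_length_le hu hT hn
  exact ⟨g, hT.of_append hl⟩

theorem sub_mem_shifts {t : List E} (hu : ¬ ι.JoinZero a b u) (ht : ι.JoinPath a b u t u)
    (ht0 : t ≠ []) (hl : ι.JoinPath a b u l w) (hm : ι.JoinPath a b u m w)
    (h : c (ι.path u l) (ι.path u m)) : (l.length : ℤ) - m.length ∈ ι.shifts a b u c := by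
  obtain ⟨g, hg⟩ := exists_return_path hu ht ht0 hl
  refine ⟨l ++ g, m ++ g, hl.append hg, hm.append hg, ?_, ?_⟩
  · rw [ι.path_append hl.1 hg.1, ι.path_append hm.1 hg.1]
    exact c.rel_mul_right _ h
  · push_cast [List.length_append]
    ring

/-- The degree `|l| - |m|` of `l m*` is thus an invariant of `c`-classes modulo `shifts`. Right
multiplication by the longer of `m`, `m'` reduces to a pair of paths. -/
theorem sub_sub_mem_shifts {t l' m' : List E} (hu : ¬ ι.JoinZero a b u)
    (ht : ι.JoinPath a b u t u) (ht0 : t ≠ [])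
    (hl : ι.JoinPath a b u l w) (hm : ι.JoinPath a b u m w)
    (hl' : ι.JoinPath a b u l' x) (hm' : ι.JoinPath a b u m' x)
    (h : c (ι.path u l * ι.star u m) (ι.path u l' * ι.star u m')) :
    ((l.length : ℤ) - m.length) - (l'.length - m'.length) ∈ ι.shifts a b u c := by
  rcases le_total m'.length m.length with hle | hle
  · obtain ⟨k, rfl⟩ := hm'.prefix_of_length_le hu hm hle
    have hk := hm.of_append hm'
    have h1 := c.rel_mul_right (ι.path u (m' ++ k)) h
    rw [mul_assoc, ι.star_mul_path hm.1, ι.path_mul_v hl.1, ι.path_append hm'.1 hk.1, mul_assoc,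
      ← mul_assoc (ι.star u m'), ι.star_mul_path hm'.1, ι.v_mul_path hk.1,
      ← ι.path_append hl'.1 hk.1] at h1
    convert sub_mem_shifts hu ht ht0 hl (hl'.append hk) h1 using 1
    push_cast [List.length_append]
    ring
  · obtain ⟨k, rfl⟩ := hm.prefix_of_length_le hu hm' hle
    have hk := hm'.of_append hm
    have h1 := c.rel_mul_right (ι.path u (m ++ k)) h
    rw [mul_assoc (ι.path u l'), ι.star_mul_path hm'.1, ι.path_mul_v hl'.1,
      ι.path_append hm.1 hk.1, mul_assoc,
      ← mul_assoc (ι.star u m), ι.star_mul_path hm.1, ι.v_mul_path hk.1,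
      ← ι.path_append hl.1 hk.1] at h1
    convert sub_mem_shifts hu ht ht0 (hl.append hk) hl' h1 using 1
    push_cast [List.length_append]
    ring

/-- The elements congruent modulo `a ⊔ b` to a vertex which is not zero modulo `a ⊔ b`. -/
theorem exists_joinPath_of_sup {y : S} (hu : ¬ ι.JoinZero a b u) (h : (a ⊔ b) (ι.v u) y) :
    ∃ l m w, ι.JoinPath a b u l w ∧ ι.JoinPath a b u m w ∧ y = ι.path u l * ι.star u m ∧
      ∀ t, ι.JoinPath a b u t u → t ≠ [] →
        (l.length : ℤ) - m.length ∈ ι.shifts a b u a ⊔ ι.shifts a b u b := by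
  -- The degree claim is conditional on a nonempty closed join path `t`, which supplies the return
  -- paths.
  refine Con.sup_induction (P := fun y => ∃ l m w, ι.JoinPath a b u l w ∧
    ι.JoinPath a b u m w ∧ y = ι.path u l * ι.star u m ∧ ∀ t, ι.JoinPath a b u t u → t ≠ [] →
      (l.length : ℤ) - m.length ∈ ι.shifts a b u a ⊔ ι.shifts a b u b) h ?_ ?_
  · exact ⟨[], [], u, joinPath_nil, joinPath_nil, (ι.vert_self u).symm, fun _ _ _ => by simp⟩
  · rintro c hc _ z h ⟨l, m, w, hl, hm, rfl, H⟩
    obtain rfl | ⟨p, q, x, l', m', hl', hm', rfl⟩ := ι.isNormal z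
    · exact absurd (ι.rel_v_zero_of_path_mul_star hl.1 hm.1 h)
        (not_rel_of_not_joinZero hc (hl.not_joinZero hu))
    · obtain ⟨rfl, rfl, hl', hm'⟩ := joinPath_of_rel hc hu hl hm hl' hm' h
      refine ⟨l', m', x, hl', hm', rfl, fun t ht ht0 => ?_⟩
      have hle : ι.shifts a b q c ≤ ι.shifts a b q a ⊔ ι.shifts a b q b := by
        rcases hc with rfl | rfl
        · exact le_sup_left
        · exact le_sup_right
      have := sub_mem (H t ht ht0) (hle (sub_sub_mem_shifts hu ht ht0 hl hm hl' hm' h))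
      rwa [sub_sub_cancel] at this

theorem sup_v_zero_iff : (a ⊔ b) (ι.v u) 0 ↔ ι.JoinZero a b u := by
  constructor
  · intro h
    by_contra hu
    obtain ⟨l, m, w, hl, hm, h0, -⟩ := exists_joinPath_of_sup hu h
    refine not_rel_of_not_joinZero (.inl rfl) (hl.not_joinZero hu)
      (ι.rel_v_zero_of_path_mul_star hl.1 hm.1 ?_)
    rw [← h0]
    exact a.refl 0
  · intro h
    have ha : a ≤ a ⊔ b := le_sup_left
    have hb : b ≤ a ⊔ b := le_sup_right
    induction h with
    | base u h => exact h.elim (fun h => ha h) (fun h => hb h)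
    | step f h _ ih =>
      have hf : ι.Exit (a ⊔ b) f := h.elim (fun h => ha h) (fun h => hb h)
      exact hf.source_zero ih

theorem exit_sup {f : E} (h : ι.Exit (a ⊔ b) f) :
    ι.JoinZero a b (Γ.s f) ∨ ι.Exit a f ∨ ι.Exit b f := by
  by_cases hu : ι.JoinZero a b (Γ.s f)
  · exact .inl hu
  obtain ⟨l, m, w, hl, hm, h0, -⟩ := exists_joinPath_of_sup hu h
  have hf : Γ.IsPath (Γ.s f) [f] (Γ.r f) := ⟨rfl, rfl⟩
  have h1 : a (ι.path (Γ.s f) l * ι.star (Γ.s f) m)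
      (ι.path (Γ.s f) [f] * ι.star (Γ.s f) [f]) := by
    rw [← h0, path_cons, path_nil, ι.edge_range, star_cons, star_nil, ι.range_star]
    exact a.refl _
  obtain ⟨-, -, h2, -⟩ := joinPath_of_rel (.inl rfl) hu hl hm hf hf h1
  exact .inr (h2.2 f (by simp))

theorem length_mem_of_sup {t : List E} (ht : Γ.IsPath u t u) (hu : ¬ ι.JoinZero a b u)
    (h : (a ⊔ b) (ι.v u) (ι.path u t)) (ht0 : t ≠ []) :
    ι.JoinPath a b u t u ∧ (t.length : ℤ) ∈ ι.shifts a b u a ⊔ ι.shifts a b u b := by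
  obtain ⟨l, m, w, hl, hm, h0, H⟩ := exists_joinPath_of_sup hu h
  -- Two expressions of the same element are trivially `a`-congruent, so the one-step lemmas compare
  -- them without uniqueness of normal forms.
  have h1 : a (ι.path u l * ι.star u m) (ι.path u t * ι.star u []) := by
    rw [← h0, star_nil, ι.path_mul_v ht]
    exact a.refl _
  obtain ⟨-, -, ht', -⟩ := joinPath_of_rel (.inl rfl) hu hl hm ht (isPath_nil.2 rfl) h1
  have h2 := sub_sub_mem_shifts hu ht' ht0 hl hm ht' joinPath_nil h1
  have h3 := sub_mem (H t ht' ht0) ((le_sup_left : _ ≤ _ ⊔ ι.shifts a b u b) h2)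
  rw [sub_sub_cancel] at h3
  exact ⟨ht', by simpa using h3⟩

/-- A closed join path whose length is a difference of lengths of closed join paths congruent
modulo `c` is congruent to its base point. -/
theorem rel_of_length_mem_shifts {t : List E} (hu : ¬ ι.JoinZero a b u)
    (ht : ι.JoinPath a b u t u) (h : (t.length : ℤ) ∈ ι.shifts a b u c) :
    c (ι.path u t) (ι.v u) := by
  obtain ⟨l, m, hl, hm, h, hk⟩ := h
  obtain rfl := hl.eq_of_length_eq hu (hm.append ht) (by rw [List.length_append]; omega)
  have := c.rel_mul_left (ι.star u m) h
  rwa [ι.path_append hm.1 ht.1, ← mul_assoc, ι.star_mul_path hm.1, ι.v_mul_path ht.1] at this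

end DirectedGraph.Rep

/-! ### From modularity to distributivity -/

namespace DirectedGraph

namespace Rep

variable {V : Type u} {E : Type v} {Γ : DirectedGraph V E} {S : Type*} [SemigroupWithZero S]
  {ι : Rep Γ S}

/-- The Rees congruence of the ideal of the elements that are zero modulo `c`. -/
def rees (c : Con S) : Con S where
  r x y := x = y ∨ c x 0 ∧ c y 0
  iseqv := ⟨fun _ => .inl rfl, by
    rintro x y (rfl | ⟨hx, hy⟩)
    · exact .inl rfl
    · exact .inr ⟨hy, hx⟩, by
    rintro x y z (rfl | ⟨hx, hy⟩) (rfl | ⟨hy', hz⟩)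
    · exact .inl rfl
    · exact .inr ⟨hy', hz⟩
    · exact .inr ⟨hx, hy⟩
    · exact .inr ⟨hx, hz⟩⟩
  mul' := by
    have hl : ∀ x y, c y 0 → c (x * y) 0 := fun x y h => by
      simpa using c.rel_mul_left x h
    have hr : ∀ x y, c x 0 → c (x * y) 0 := fun x y h => by
      simpa using c.rel_mul_right y h
    rintro w x y z (rfl | ⟨hw, hx⟩) (rfl | ⟨hy, hz⟩)
    · exact .inl rfl
    · exact .inr ⟨hl _ _ hy, hl _ _ hz⟩
    · exact .inr ⟨hr _ _ hw, hr _ _ hx⟩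
    · exact .inr ⟨hr _ _ hw, hr _ _ hx⟩

theorem rees_iff {c : Con S} {x y : S} : rees c x y ↔ x = y ∨ c x 0 ∧ c y 0 := Iff.rfl

theorem rees_le (c : Con S) : rees c ≤ c := by
  rintro x y (rfl | ⟨hx, hy⟩)
  · exact c.refl x
  · exact c.trans hx (c.symm hy)

/-- In a modular congruence lattice, two distinct edges with the same source `u` cannot be
identified with `u` by two congruences for which `u` is not zero. -/
theorem no_fork (hmod : LatticeIsModular (Con S)) {a c : Con S} {e f : E}
    (hs : Γ.s e = Γ.s f) (hef : e ≠ f) (he : ι.Exit a e) (hf : ι.Exit c f) :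
    a (ι.v (Γ.s e)) 0 ∨ c (ι.v (Γ.s e)) 0 := by
  by_contra! h
  obtain ⟨h0a, h0c⟩ := h
  have hec : c (ι.v (Γ.r e)) 0 := hf.range_zero hs.symm (Ne.symm hef)
  have hsup : (rees c ⊔ a) (ι.v (Γ.s e)) 0 := by
    have hac : ι.Exit (rees c ⊔ a) e := (le_sup_right : a ≤ rees c ⊔ a) he
    exact hac.source_zero
      ((le_sup_left : rees c ≤ rees c ⊔ a) (rees_iff.2 (.inr ⟨hec, c.refl 0⟩)))
  -- The modular law is applied to `rees c ≤ c`: `f` is an exit of `(rees c ⊔ a) ⊓ c`, as `rees c ⊔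
  -- a` kills its source.
  have hexit : ι.Exit (rees c ⊔ (a ⊓ c)) f := by
    unfold Exit
    rw [hmod (rees c) a c (rees_le c)]
    exact Con.inf_iff_and.2 ⟨ι.exit_of_source_zero (hs ▸ hsup), hf⟩
  -- Such a `g` would be an exit of both `a` and `c`, hence equal to both `e` and `f`.
  have key : ∀ g, Γ.s g = Γ.s e → ¬ (ι.Exit (rees c) g ∨ ι.Exit (a ⊓ c) g) := by
    intro g hg h
    have hg' : ι.Exit a g ∧ ι.Exit c g := by
      rcases h with h | h
      · rcases rees_iff.1 h with h | h
        · unfold Exit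
          rw [← h]
          exact ⟨a.refl _, c.refl _⟩
        · exact absurd (hg ▸ h.1) h0c
      · exact Con.inf_iff_and.1 h
    have h1 := (he.eq_or_zero hg'.1 hg.symm).resolve_right h0a
    have h2 := (hf.eq_or_zero hg'.2 (hs.symm.trans hg.symm)).resolve_right (hs ▸ h0c)
    exact hef (h1.trans h2.symm)
  rcases exit_sup hexit with h | h
  · rw [← hs] at h
    generalize hu : Γ.s e = u at h
    cases h with
    | base _ h =>
      subst hu
      rcases h with h | h
      · rcases rees_iff.1 h with h | h
        · exact h0c (h ▸ c.refl _)
        · exact h0c h.1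
      · exact h0a (Con.inf_iff_and.1 h).1
    | step g h _ => exact key g hu.symm h
  · exact key f hs.symm h

theorem sup_inf_le_of_modular (ι : Rep Γ S) (hmod : LatticeIsModular (Con S)) (a b c : Con S) :
    (a ⊔ b) ⊓ c ≤ (a ⊓ c) ⊔ (b ⊓ c) := by
  set d := (a ⊓ c) ⊔ (b ⊓ c) with hd
  have had : ∀ {x y}, a x y → c x y → d x y := fun h h' =>
    (le_sup_left : a ⊓ c ≤ d) (Con.inf_iff_and.2 ⟨h, h'⟩)
  have hbd : ∀ {x y}, b x y → c x y → d x y := fun h h' =>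
    (le_sup_right : b ⊓ c ≤ d) (Con.inf_iff_and.2 ⟨h, h'⟩)
  have habd : ∀ {x y}, a x y ∨ b x y → c x y → d x y := fun h h' =>
    h.elim (fun h => had h h') (fun h => hbd h h')
  -- Being zero modulo `c` passes along paths, so every edge on the way is also an exit of `c`.
  have hH : ∀ u, ι.JoinZero a b u → c (ι.v u) 0 → d (ι.v u) 0 := by
    intro u h
    induction h with
    | base u h => exact habd h
    | step f h _ ih =>
      intro h0
      have h0' : c (ι.v (Γ.r f)) 0 :=
        ι.rel_v_zero_of_source (l := [f]) ⟨rfl, rfl⟩ h0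
      have hf : ι.Exit d f := habd h (ι.exit_of_zero h0 h0')
      exact hf.source_zero (ih h0')
  have fork : ∀ {e f : E}, Γ.s e = Γ.s f → (ι.Exit a e ∨ ι.Exit b e) → ι.Exit c f →
      e = f ∨ c (ι.v (Γ.s e)) 0 ∨ a (ι.v (Γ.s e)) 0 ∨ b (ι.v (Γ.s e)) 0 := by
    intro e f hs he hf
    by_cases hef : e = f
    · exact .inl hef
    · rcases he with he | he
      · have := no_fork hmod hs hef he hf
        tauto
      · have := no_fork hmod hs hef he hf
        tauto
  -- By `fork`, the cycle follows the exits leading to a zero vertex unless the base is already zero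
  -- in `a`, `b` or `c`. Rotating the cycle moves the base forward, and zero returns along the rest
  -- of the cycle.
  have hcycle : ∀ u, ι.JoinZero a b u → ∀ t, Γ.IsPath u t u → t ≠ [] →
      c (ι.v u) (ι.path u t) → c (ι.v u) 0 ∨ a (ι.v u) 0 ∨ b (ι.v u) 0 := by
    intro u h
    induction h with
    | base u h => exact fun _ _ _ _ => .inr h
    | step f h _ ih =>
      intro t ht ht0 hct
      cases t with
      | nil => exact absurd rfl ht0
      | cons g t =>
        obtain ⟨hg, ht⟩ := ht
        rw [path_cons] at hct
        rcases fork hg.symm h (ι.exit_of_rel (hg ▸ hct)) with rfl | h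
        · have hf : Γ.IsPath (Γ.s f) [f] (Γ.r f) := ⟨rfl, rfl⟩
          have h1 := c.rel_mul_right (ι.e f) (c.rel_mul_left (ι.t f) hct)
          rw [ι.star_source, ι.star_edge_self, ι.t_mul_e_mul_path ht] at h1
          have h2 : c (ι.v (Γ.r f)) (ι.path (Γ.r f) (t ++ [f])) := by
            rwa [ι.path_append ht hf, path_cons, path_nil, ι.edge_range]
          have h3 : ∀ {ρ : Con S}, ρ (ι.v (Γ.r f)) 0 → ρ (ι.v (Γ.s f)) 0 :=
            fun h => ι.rel_v_zero_of_source ht h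
          exact (ih _ (ht.append hf) (by simp) h2).imp h3 (Or.imp h3 h3)
        · exact h
  refine ι.le_of_basic ?_ ?_ ?_
  · intro f h
    obtain ⟨hab, hc⟩ := Con.inf_iff_and.1 h
    rcases exit_sup hab with hu | h
    · have hzero : c (ι.v (Γ.s f)) 0 → ι.Exit d f := fun h =>
        ι.exit_of_source_zero (hH _ hu h)
      have hab0 : a (ι.v (Γ.s f)) 0 ∨ b (ι.v (Γ.s f)) 0 → ι.Exit d f := fun h =>
        habd (h.imp ι.exit_of_source_zero ι.exit_of_source_zero) hc
      have hu' := hu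
      generalize hx : Γ.s f = x at hu'
      cases hu' with
      | base _ h => exact hab0 (hx ▸ h)
      | step g hg _ =>
        rcases fork hx.symm hg hc with rfl | h'
        · exact habd hg hc
        · rw [← hx] at h'
          exact h'.elim hzero hab0
    · exact habd h hc
  · intro u t ht h
    by_cases ht0 : t = []
    · subst ht0
      exact d.refl _
    obtain ⟨hab, hc⟩ := Con.inf_iff_and.1 h
    by_cases hu : ι.JoinZero a b u
    · have hzero : ∀ {ρ : Con S}, ρ (ι.v u) 0 → ρ (ι.path u t) (ι.v u) := fun {ρ} h =>
        ρ.trans (ι.rel_path_zero ht h) (ρ.symm h)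
      rcases hcycle u hu t ht ht0 (c.symm hc) with h | h
      · exact hzero (hH u hu h)
      · exact habd (h.imp hzero hzero) hc
    · obtain ⟨ht', hmem⟩ := length_mem_of_sup ht hu ((a ⊔ b).symm hab) ht0
      have hmem' : (t.length : ℤ) ∈ ι.shifts a b u c :=
        ⟨t, [], ht', joinPath_nil, hc, by simp⟩
      refine rel_of_length_mem_shifts hu ht' ?_
      -- All the subgroups use the join paths of the same `a` and `b`, so distributivity in `ℤ`
      -- applies to them directly.
      have hle : (ι.shifts a b u a ⊓ ι.shifts a b u c) ⊔ (ι.shifts a b u b ⊓ ι.shifts a b u c) ≤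
          ι.shifts a b u d :=
        sup_le ((shifts_inf_le hu).trans (shifts_mono le_sup_left))
          ((shifts_inf_le hu).trans (shifts_mono le_sup_right))
      exact hle (AddSubgroup.int_sup_inf_le _ _ _ ⟨hmem, hmem'⟩)
  · intro u h
    obtain ⟨hab, hc⟩ := Con.inf_iff_and.1 h
    exact hH u (sup_v_zero_iff.1 hab) hc

end Rep

/-! ### The graph inverse semigroup as an instance -/

section Inv

variable {V : Type u} {E : Type v} (Γ : DirectedGraph V E)

instance Inv.semigroupWithZero : SemigroupWithZero Γ.Inv where
  __ := Con.semigroup (conGen (InvRel Γ))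
  zero := ((0 : FreeWithZero V E) : (conGen (InvRel Γ)).Quotient)
  zero_mul x := by
    induction x using Con.induction_on with
    | H x => exact congrArg Con.toQuotient (zero_mul x)
  mul_zero x := by
    induction x using Con.induction_on with
    | H x => exact congrArg Con.toQuotient (mul_zero x)

/-- The generators of the graph inverse semigroup. -/
def Inv.rep : Rep Γ Γ.Inv where
  v a := ((wv a : FreeWithZero V E) : (conGen (InvRel Γ)).Quotient)
  e f := ((we f : FreeWithZero V E) : (conGen (InvRel Γ)).Quotient)
  t f := ((ws f : FreeWithZero V E) : (conGen (InvRel Γ)).Quotient)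
  vert_self a := (Con.eq _).2 (.of _ _ (.vert_self a))
  vert_ne a b h := (Con.eq _).2 (.of _ _ (.vert_ne a b h))
  source_edge f := (Con.eq _).2 (.of _ _ (.source_edge f))
  edge_range f := (Con.eq _).2 (.of _ _ (.edge_range f))
  range_star f := (Con.eq _).2 (.of _ _ (.range_star f))
  star_source f := (Con.eq _).2 (.of _ _ (.star_source f))
  star_edge_self f := (Con.eq _).2 (.of _ _ (.star_edge_self f))
  star_edge_ne f g h := (Con.eq _).2 (.of _ _ (.star_edge_ne f g h))
  induction_on P zero vert edge star mul x := by
    induction x using Con.induction_on with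
    | H x =>
      induction x using WithZero.recZeroCoe with
      | zero => exact zero
      | coe x =>
        have gen : ∀ g : Gen V E, P (((FreeSemigroup.of g : FreeSemigroup (Gen V E)) :
            FreeWithZero V E) : (conGen (InvRel Γ)).Quotient)
          | .vert a => vert a
          | .edge f => edge f
          | .star f => star f
        induction x using FreeSemigroup.recOnMul with
        | ih1 g => exact gen g
        | ih2 g y hg hy => exact mul _ _ hg hy

end Inv

end DirectedGraph

/-- `Con Γ.Inv` is the lattice of all congruences on the semigroup `Γ.Inv`, ordered by inclusion. -/
theorem lemma3p2 {V : Type u} {E : Type v} (Γ : DirectedGraph V E) :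
    LatticeIsModular (Con Γ.Inv) ↔ LatticeIsDistributive (Con Γ.Inv) := by
  constructor
  · intro hmod a b c
    exact le_antisymm ((DirectedGraph.Inv.rep Γ).sup_inf_le_of_modular hmod a b c)
      (sup_le (inf_le_inf_right c le_sup_left) (inf_le_inf_right c le_sup_right))
  · intro hdist a b c hac
    rw [hdist a b c, inf_eq_left.2 hac]
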